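/- An mm-space is a triple $X=(X,d_X,\mu_X)$ where $(X,d_X)$ is a complete separable metric space and $\mu_X$ is a Borel probability measure on $X$. An mm-space $Y$ dominates $X$, written $Y\succ X$, if there is a $1$-Lipschitz map $F:Y\to X$ with $F_*\mu_Y=\mu_X$. Let $n\in\mathbb N\cup\{\infty\}$, let $\mathbb N_n=\{i\in\mathbb N : 1\le i\le n\}$ (so $\mathbb N_\infty=\{1,2,\dots\}$), and let $\alpha=(\alpha_i)_{i\in\mathbb N_n}$ be a family of positive real numbers. For an mm-space $X$ let $D_X(\alpha)$ be the set of families $(A_i)_{i\in\mathbb N_n}$ of pairwise disjoint Borel subsets of $X$ with $\mu_X(A_i)\ge\alpha_i$ for all $i\in\mathbb N_n$, and define, with values in $[0,\infty]$, \[ \operatorname{diam}(X;\alpha)=\inf\Big\{\sup_{i\in\mathbb N_n}\operatorname{diam}A_i \;\Big|\; (A_i)_{i\in\mathbb N_n}\in D_X(\alpha)\Big\}\qquad(\inf\emptyset=\infty), \] \[ \underline{\operatorname{diam}}(X;\alpha)=\inf_{Y\succ X}\operatorname{diam}(Y;\alpha), \] \[ \underline{\operatorname{Obsdiam}}(X;\alpha)=\sup\big\{\underline{\operatorname{diam}}\big((\mathbb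 R,|\cdot|,f_*\mu_X);\alpha\big)\;\big|\; f:X\to\mathbb R \text{ is } 1\text{-Lipschitz}\big\}. \] Then, for every mm-space $X$ and every such $\alpha$, the following four conditions are equivalent: 1. there exist an mm-space $Y$ with $Y\succ X$ and pairwise distinct points $y_i\in Y$ ($i\in\mathbb N_n$) such that $\mu_Y(\{y_i\})\ge\alpha_i$ for every $i\in\mathbb N_n$; 2. there exist (not necessarily distinct) points $x_i\in X$ ($i\in\mathbb N_n$) such that $\mu_X(\{x_i\mid i\in I\})\ge\sum_{i\in I}\alpha_i$ for every subset $I\subset\mathbb N_n$; 3. $\underline{\operatorname{diam}}(X;\alpha)=0$; 4. $\underline{\operatorname{Obsdiam}}(X;\alpha)=0$. -/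

import Mathlib

open MeasureTheory
open scoped ENNReal

universe u v w

/-- An mm-space: a complete separable metric space with a Borel probability measure. -/
structure MMSpace : Type (u + 1) where
  carrier : Type u
  [metricSpace : MetricSpace carrier]
  [completeSpace : CompleteSpace carrier]
  [separableSpace : TopologicalSpace.SeparableSpace carrier]
  [measurableSpace : MeasurableSpace carrier]
  [borelSpace : BorelSpace carrier]
  μ : Measure carrier
  [isProbabilityMeasure : IsProbabilityMeasure μ]

namespace MMSpace

instance : CoeSort MMSpace.{u} (Type u) := ⟨MMSpace.carrier⟩

attribute [instance] MMSpace.metricSpace MMSpace.completeSpace MMSpace.separableSpace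
  MMSpace.measurableSpace MMSpace.borelSpace MMSpace.isProbabilityMeasure

/-- `Y.Dominates X` is the Lipschitz order `Y ≻ X`. -/
def Dominates (Y : MMSpace.{u}) (X : MMSpace.{v}) : Prop :=
  ∃ F : Y → X, LipschitzWith 1 F ∧ Measure.map F Y.μ = X.μ

/-- The families of pairwise disjoint Borel subsets `A i` of `X` with `μ_X (A i) ≥ α i`. -/
def partialFamilies (X : MMSpace.{u}) {ι : Type w} (α : ι → ℝ) : Set (ι → Set X) :=
  {A | (∀ i, MeasurableSet (A i)) ∧ Pairwise (fun i j => Disjoint (A i) (A j)) ∧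
    ∀ i, ENNReal.ofReal (α i) ≤ X.μ (A i)}

/-- `diam(X; α)`; it is `∞` if there is no admissible family. -/
noncomputable def partialDiam (X : MMSpace.{u}) {ι : Type w} (α : ι → ℝ) : ℝ≥0∞ :=
  ⨅ A ∈ X.partialFamilies α, ⨆ i, Metric.ediam (A i)

/-- The infimum of `diam(Y; α)` over all mm-spaces `Y` dominating `X`. -/
noncomputable def udiam (X : MMSpace.{u}) {ι : Type w} (α : ι → ℝ) : ℝ≥0∞ :=
  ⨅ (Y : MMSpace.{u}) (_ : Y.Dominates X), Y.partialDiam α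

/-- The mm-space `(ℝ, f_* μ_X)` for a 1-Lipschitz function `f` on `X`. -/
noncomputable def pushReal (X : MMSpace.{u}) (f : X → ℝ) (hf : LipschitzWith 1 f) :
    MMSpace.{0} where
  carrier := ℝ
  μ := Measure.map f X.μ
  isProbabilityMeasure :=
    Measure.isProbabilityMeasure_map hf.continuous.measurable.aemeasurable

/-- The supremum of `udiam((ℝ, f_* μ_X); α)` over all 1-Lipschitz functions `f : X → ℝ`. -/
noncomputable def uObsdiam (X : MMSpace.{u}) {ι : Type w} (α : ι → ℝ) : ℝ≥0∞ :=
  ⨆ (f : X → ℝ) (hf : LipschitzWith 1 f), (X.pushReal f hf).udiam α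

end MMSpace

/-- The index set `ℕ ∩ [1, n]` for `n ∈ ℕ ∪ {∞}`. -/
abbrev NatUpTo (n : ℕ∞) : Type := {i : ℕ // 1 ≤ i ∧ (i : ℕ∞) ≤ n}

/-!
A family of disjoint sets in `Y ≻ X` pushes forward to sets in `X` that need not be disjoint, but
whose finite unions are still as heavy as the sum of the weights. If the diameters tend to `0`,
tightness of `μ_X` keeps these sets near fixed compact sets, so along an ultrafilter they converge
to points, and outer regularity preserves the inequality in the limit. Conversely, points `x i` with
`∑ α i • δ_{x i} ≤ μ_X` become distinct in `X × ℕ`, where each mass `α i` is moved to its own level.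

For the observable version, one 1-Lipschitz function `f : X → ℝ` that is injective up to a null set
of pairs suffices, since then each atom of `f_* μ_X` comes from a single atom of `μ_X`. Such an `f`
is the Abel mean at a generic `s ∈ (0, 1)` of an isometric embedding of `X` in `ℓ^∞`: for `x ≠ y`
the parameters `s` at which `x` and `y` collide are zeros of a nonzero power series, so by Fubini
there is an `s` at which almost no pairs collide.
-/

open Filter Topology
open scoped lp

section Carries

variable {X Y ι : Type*} [MeasurableSpace X] [MeasurableSpace Y] {w : ι → ℝ≥0∞}

/-- The sets `B i` simultaneously host the weights `w i` in `μ`: any finitely many of them have a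
union of measure at least the sum of their weights. This is a Hall-type condition on overlapping
sets; for singletons it asks that `μ` dominate the sum of the point masses `w i` at the given points
(`Carries.sum_smul_dirac_le`). The sets need not be measurable, `μ` being read as an outer measure
on them, so that the condition passes to images. -/
def Carries (μ : Measure X) (w : ι → ℝ≥0∞) (B : ι → Set X) : Prop :=
  ∀ J : Finset ι, ∑ i ∈ J, w i ≤ μ (⋃ i ∈ J, B i)

namespace Carries

variable {μ : Measure X}

theorem of_pairwise_disjoint {A : ι → Set X} (hA : ∀ i, MeasurableSet (A i))
    (hd : Pairwise fun i j ↦ Disjoint (A i) (A j)) (hw : ∀ i, w i ≤ μ (A i)) :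
    Carries μ w A := fun J ↦
  calc ∑ i ∈ J, w i ≤ ∑ i ∈ J, μ (A i) := Finset.sum_le_sum fun i _ ↦ hw i
    _ = μ (⋃ i ∈ J, A i) :=
      (measure_biUnion_finset (fun _ _ _ _ hij ↦ hd hij) fun i _ ↦ hA i).symm

theorem image_map {A : ι → Set X} (hA : Carries μ w A) {F : X → Y} (hF : AEMeasurable F μ) :
    Carries (μ.map F) w fun i ↦ F '' A i := fun J ↦
  calc ∑ i ∈ J, w i ≤ μ (⋃ i ∈ J, A i) := hA J
    _ ≤ μ.map F (F '' ⋃ i ∈ J, A i) := Measure.le_map_apply_image hF _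
    _ = μ.map F (⋃ i ∈ J, F '' A i) := by rw [Set.image_iUnion₂]

theorem tsum_le {B : ι → Set X} (hB : Carries μ w B) (I : Set ι) :
    ∑' i : I, w i ≤ μ (⋃ i ∈ I, B i) := by
  rw [ENNReal.tsum_eq_iSup_sum]
  refine iSup_le fun J ↦ ?_
  calc ∑ i ∈ J, w i = ∑ i ∈ J.map (.subtype _), w i := (J.sum_map (.subtype (· ∈ I)) w).symm
    _ ≤ μ (⋃ i ∈ J.map (.subtype _), B i) := hB _
    _ ≤ μ (⋃ i ∈ I, B i) := measure_mono <| Set.biUnion_mono (fun i hi ↦ by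
        obtain ⟨j, -, rfl⟩ := Finset.mem_map.1 hi
        exact j.2) fun _ _ ↦ subset_rfl

theorem countable [IsFiniteMeasure μ] {B : ι → Set X} (hB : Carries μ w B) (hw : ∀ i, w i ≠ 0) :
    Countable ι := by
  have hsum : ∑' i, w i ≠ ∞ := by
    rw [← tsum_univ w]
    exact ((hB.tsum_le Set.univ).trans_lt (measure_lt_top μ _)).ne
  rw [← Set.countable_univ_iff]
  exact (Summable.countable_support_ennreal hsum).mono fun i _ ↦ hw i

theorem inter_nonempty {B : ι → Set X} (hB : Carries μ w B) {K : Set X} {i : ι}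
    (hK : μ Kᶜ < w i) : (B i ∩ K).Nonempty := by
  by_contra hne
  have hBK : B i ⊆ Kᶜ := Set.disjoint_iff_inter_eq_empty.2 (Set.not_nonempty_iff_eq_empty.1 hne)
    |>.subset_compl_right
  have hi : w i ≤ μ (B i) := by simpa using hB {i}
  exact (hK.trans_le (hi.trans (measure_mono hBK))).false

theorem of_tendsto_smallSets [TopologicalSpace X] [μ.OuterRegular] {β : Type*} {l : Filter β}
    [l.NeBot] {B : β → ι → Set X} {x : ι → X} (hB : ∀ᶠ b in l, Carries μ w (B b))
    (hx : ∀ i, Tendsto (fun b ↦ B b i) l (𝓝 (x i)).smallSets) :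
    Carries μ w fun i ↦ {x i} := fun J ↦ by
  rw [Set.measure_eq_iInf_isOpen]
  refine le_iInf₂ fun U hU ↦ le_iInf fun hUo ↦ ?_
  have hsub : ∀ᶠ b in l, ∀ i ∈ J, B b i ⊆ U := J.eventually_all.2 fun i hi ↦
    tendsto_smallSets_iff.1 (hx i) U (hUo.mem_nhds (hU (Set.mem_biUnion hi rfl)))
  obtain ⟨b, hb, hbU⟩ := (hB.and hsub).exists
  exact (hb J).trans (measure_mono (Set.iUnion₂_subset hbU))

theorem exists_of_map {f : X → Y} [MeasurableSingletonClass Y] (hf : Measurable f)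
    (hinj : ∀ᵐ x ∂μ, ∀ᵐ y ∂μ, f x = f y → x = y) {t : ι → Y} (hw : ∀ i, w i ≠ 0)
    (ht : Carries (μ.map f) w fun i ↦ {t i}) :
    ∃ x : ι → X, Carries μ w fun i ↦ {x i} := by
  have hfib : ∀ i, ∃ x, f ⁻¹' {t i} ≤ᵐ[μ] ({x} : Set X) := fun i ↦ by
    have hpos : μ (f ⁻¹' {t i}) ≠ 0 := by
      rw [← Measure.map_apply hf (measurableSet_singleton _)]
      exact ((hw i).bot_lt.trans_le (by simpa using ht {i})).ne'
    obtain ⟨x, hxt, hx⟩ := ((frequently_ae_mem_iff.2 hpos).and_eventually hinj).exists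
    exact ⟨x, hx.mono fun y hy hyt ↦ (hy (Eq.trans hxt (Eq.symm hyt))).symm⟩
  choose x hx using hfib
  refine ⟨x, fun J ↦ ?_⟩
  calc ∑ i ∈ J, w i ≤ μ.map f (⋃ i ∈ J, {t i}) := ht J
    _ = μ (⋃ i ∈ J, f ⁻¹' {t i}) := by
      rw [Measure.map_apply hf (J.measurableSet_biUnion fun i _ ↦ measurableSet_singleton _),
        Set.preimage_iUnion₂]
    _ ≤ μ (⋃ i ∈ J, {x i}) := measure_mono_ae (J.eventuallyLE_iUnion fun i _ ↦ hx i)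

theorem sum_smul_dirac_le {x : ι → X} (hx : Carries μ w fun i ↦ {x i}) :
    Measure.sum (fun i ↦ w i • Measure.dirac (x i)) ≤ μ := by
  refine Measure.le_iff.2 fun s hs ↦ ?_
  calc Measure.sum (fun i ↦ w i • Measure.dirac (x i)) s
      = ∑' i : (x ⁻¹' s), w i := by
        rw [Measure.sum_apply _ hs, tsum_subtype]
        refine tsum_congr fun i ↦ ?_
        by_cases hi : x i ∈ s <;> simp [hs, hi]
    _ ≤ μ (⋃ i ∈ x ⁻¹' s, {x i}) := hx.tsum_le _
    _ ≤ μ s := measure_mono (Set.iUnion₂_subset fun i hi ↦ Set.singleton_subset_iff.2 hi)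

theorem exists_map_fst_eq [Countable ι] [IsFiniteMeasure μ] {x : ι → X}
    (hx : Carries μ w fun i ↦ {x i}) :
    ∃ ν : Measure (X × ℕ), ν.map Prod.fst = μ ∧
      ∃ y : ι → X × ℕ, Function.Injective y ∧ ∀ i, w i ≤ ν {y i} := by
  obtain ⟨e, he⟩ := exists_injective_nat ι
  set σ : Measure X := .sum fun i ↦ w i • .dirac (x i)
  set τ : Measure (X × ℕ) := .sum fun i ↦ w i • .dirac (x i, e i)
  have hσ : σ ≤ μ := hx.sum_smul_dirac_le
  have : IsFiniteMeasure σ := isFiniteMeasure_of_le μ hσ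
  have hτ : τ.map Prod.fst = σ := by
    simp only [τ, σ, Measure.map_sum measurable_fst.aemeasurable, Measure.map_smul,
      Measure.map_dirac' measurable_fst]
  refine ⟨(μ - σ).map (·, 0) + τ, ?_, fun i ↦ (x i, e i),
    fun i j h ↦ he (congrArg Prod.snd h), fun i ↦ ?_⟩
  · rw [Measure.map_add _ _ measurable_fst, hτ,
      Measure.map_map measurable_fst measurable_prodMk_right]
    exact (congrArg (· + σ) Measure.map_id).trans (Measure.sub_add_cancel_of_le hσ)
  · calc w i ≤ (w i • Measure.dirac (x i, e i)) {(x i, e i)} := by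
          rw [Measure.smul_apply, smul_eq_mul]
          exact le_mul_of_one_le_right' (by simp)
      _ ≤ τ {(x i, e i)} := Measure.le_sum _ i _
      _ ≤ _ := Measure.le_add_left le_rfl _

end Carries

theorem carries_singleton_iff {μ : Measure X} {x : ι → X} :
    Carries μ w (fun i ↦ {x i}) ↔ ∀ I : Set ι, ∑' i : I, w i ≤ μ (x '' I) := by
  refine ⟨fun hx I ↦ ?_, fun hx J ↦ ?_⟩
  · simpa only [Set.image_eq_iUnion] using hx.tsum_le I
  · rw [← Finset.tsum_subtype']
    simpa only [Set.image_eq_iUnion, Finset.mem_coe] using hx J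

end Carries

theorem tendsto_smallSets_nhds_of_ediam {X β : Type*} [PseudoEMetricSpace X] {l : Filter β}
    {B : β → Set X} {z : β → X} {x : X} (hzB : ∀ b, z b ∈ B b)
    (hdiam : Tendsto (fun b ↦ Metric.ediam (B b)) l (𝓝 0)) (hz : Tendsto z l (𝓝 x)) :
    Tendsto B l (𝓝 x).smallSets := by
  refine (Metric.nhds_basis_eball.smallSets.tendsto_right_iff).2 fun ε hε ↦ ?_
  have hε2 := ENNReal.half_pos hε.ne'
  filter_upwards [hdiam.eventually_lt_const hε2, EMetric.tendsto_nhds.1 hz _ hε2] with b hb hzb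
  intro y hy
  calc edist y x ≤ edist y (z b) + edist (z b) x := edist_triangle _ _ _
    _ < ε / 2 + ε / 2 :=
      ENNReal.add_lt_add ((Metric.edist_le_ediam_of_mem hy (hzB b)).trans_lt hb) hzb
    _ = ε := ENNReal.add_halves ε

theorem exists_carries_singleton_of_forall_ediam_le {X : Type*} [EMetricSpace X] [CompleteSpace X]
    [SecondCountableTopology X] [MeasurableSpace X] [BorelSpace X] {μ : Measure X}
    [IsFiniteMeasure μ] {ι : Type*} {w : ι → ℝ≥0∞} (hw : ∀ i, w i ≠ 0)
    (h : ∀ ε > 0, ∃ B : ι → Set X, Carries μ w B ∧ ∀ i, Metric.ediam (B i) ≤ ε) :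
    ∃ x : ι → X, Carries μ w fun i ↦ {x i} := by
  obtain ⟨ε, -, hε, hε0⟩ := exists_seq_strictAnti_tendsto' (show (0 : ℝ≥0∞) < 1 from one_pos)
  choose B hB hBε using fun k : ℕ ↦ h (ε k) (hε k).1
  choose K hKc hK using fun i ↦ show ∃ K : Set X, IsCompact K ∧ μ Kᶜ < w i by
    obtain ⟨K, -, hKc, hK⟩ :=
      MeasurableSet.univ.exists_isCompact_sdiff_lt (measure_ne_top μ _) (hw i)
    exact ⟨K, hKc, by rwa [Set.compl_eq_univ_sdiff]⟩
  choose z hzB hzK using fun k i ↦ (hB k).inter_nonempty (hK i)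
  choose x hx using fun i ↦ show ∃ x, Tendsto (z · i) (hyperfilter ℕ : Filter ℕ) (𝓝 x) by
    obtain ⟨x, -, hx⟩ := (hKc i).ultrafilter_le_nhds ((hyperfilter ℕ).map (z · i))
      (tendsto_principal.2 (.of_forall (hzK · i)))
    exact ⟨x, hx⟩
  refine ⟨x, .of_tendsto_smallSets (l := hyperfilter ℕ) (.of_forall hB) fun i ↦
    tendsto_smallSets_nhds_of_ediam (hzB · i) ?_ (hx i)⟩
  exact (tendsto_of_tendsto_of_tendsto_of_le_of_le tendsto_const_nhds hε0 (fun _ ↦ zero_le)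
    (hBε · i)).mono_left Nat.hyperfilter_le_atTop

theorem ae_restrict_eball_ne_zero {𝕜 E : Type*} [RCLike 𝕜] [MeasurableSpace 𝕜] [BorelSpace 𝕜]
    [NormedAddCommGroup E] [NormedSpace 𝕜 E] [CompleteSpace E] {μ : Measure 𝕜}
    [NullSingletonClass μ] {f : 𝕜 → E} {p : FormalMultilinearSeries 𝕜 𝕜 E} {x : 𝕜}
    {r : ℝ≥0∞} (hf : HasFPowerSeriesOnBall f p x r) (hp : p ≠ 0) :
    ∀ᵐ z ∂μ.restrict (Metric.eball x r), f z ≠ 0 := by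
  obtain ⟨y, hy, hfy⟩ : ∃ y ∈ Metric.eball x r, f y ≠ 0 := by
    contrapose! hp
    exact hf.hasFPowerSeriesAt.locally_zero_iff.1
      (mem_of_superset (Metric.eball_mem_nhds x hf.r_pos) hp)
  exact ae_restrict_le_codiscreteWithin Metric.isOpen_eball.measurableSet
    (hf.analyticOnNhd.preimage_zero_mem_codiscreteWithin hfy hy
      ⟨⟨y, hy⟩, Metric.isPreconnected_eball⟩)

theorem hasFPowerSeriesOnBall_tsum_pow_mul {𝕜 : Type*} [NontriviallyNormedField 𝕜]
    [CompleteSpace 𝕜] (c : ℓ^∞(ℕ, 𝕜)) :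
    HasFPowerSeriesOnBall (fun s ↦ ∑' k, s ^ k * c k)
      (FormalMultilinearSeries.ofScalars 𝕜 (c : ℕ → 𝕜)) 0 1 := by
  have hr : 1 ≤ (FormalMultilinearSeries.ofScalars 𝕜 (c : ℕ → 𝕜)).radius := by
    refine FormalMultilinearSeries.le_radius_of_bound _ (r := 1) ‖c‖ fun k ↦ ?_
    simpa [FormalMultilinearSeries.ofScalars_norm] using
      lp.norm_apply_le_norm ENNReal.top_ne_zero c k
  convert! (FormalMultilinearSeries.hasFPowerSeriesOnBall _ (one_pos.trans_le hr)).mono one_pos hr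
    using 1
  funext s
  refine tsum_congr fun k ↦ ?_
  rw [FormalMultilinearSeries.ofScalars_apply_eq, smul_eq_mul, mul_comm]

section AbelMean

/-- The Abel mean `(1 - s) ∑ sᵏ cₖ` of a bounded sequence, an average of its terms with geometric
weights when `0 < s < 1`; these means are used as 1-Lipschitz functionals on `ℓ^∞` that depend
analytically on `s`. For `|s| ≥ 1` the sum may diverge, and then the value is the junk value `0`. -/
noncomputable def abelMean (s : ℝ) (c : ℓ^∞(ℕ, ℝ)) : ℝ :=
  (1 - s) * ∑' k, s ^ k * c k

theorem mem_eball_zero_one {s : ℝ} (hs : s ∈ Set.Ioo 0 1) : s ∈ Metric.eball (0 : ℝ) 1 := by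
  rw [← ENNReal.ofReal_one, Metric.eball_ofReal, mem_ball_zero_iff, Real.norm_of_nonneg hs.1.le]
  exact hs.2

variable {s : ℝ}

theorem norm_pow_mul_le (hs : s ∈ Set.Ioo 0 1) (c : ℓ^∞(ℕ, ℝ)) (k : ℕ) :
    ‖s ^ k * c k‖ ≤ s ^ k * ‖c‖ := by
  rw [norm_mul, Real.norm_of_nonneg (pow_nonneg hs.1.le k)]
  exact mul_le_mul_of_nonneg_left (lp.norm_apply_le_norm ENNReal.top_ne_zero c k)
    (pow_nonneg hs.1.le k)

theorem summable_pow_mul (hs : s ∈ Set.Ioo 0 1) (c : ℓ^∞(ℕ, ℝ)) : Summable fun k ↦ s ^ k * c k :=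
  ((summable_geometric_of_lt_one hs.1.le hs.2).mul_right ‖c‖).of_norm_bounded (norm_pow_mul_le hs c)

theorem abelMean_sub (hs : s ∈ Set.Ioo 0 1) (c d : ℓ^∞(ℕ, ℝ)) :
    abelMean s (c - d) = abelMean s c - abelMean s d := by
  simp only [abelMean, lp.coeFn_sub, Pi.sub_apply, mul_sub,
    (summable_pow_mul hs c).tsum_sub (summable_pow_mul hs d)]

theorem abs_abelMean_le (hs : s ∈ Set.Ioo 0 1) (c : ℓ^∞(ℕ, ℝ)) : |abelMean s c| ≤ ‖c‖ := by
  have hs' : 0 < 1 - s := sub_pos.2 hs.2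
  calc |abelMean s c| = (1 - s) * ‖∑' k, s ^ k * c k‖ := by
        rw [abelMean, abs_mul, abs_of_pos hs', Real.norm_eq_abs]
    _ ≤ (1 - s) * ((1 - s)⁻¹ * ‖c‖) := by
        gcongr
        exact tsum_of_norm_bounded ((hasSum_geometric_of_lt_one hs.1.le hs.2).mul_right ‖c‖)
          (norm_pow_mul_le hs c)
    _ = ‖c‖ := mul_inv_cancel_left₀ hs'.ne' _

theorem lipschitzWith_abelMean (hs : s ∈ Set.Ioo 0 1) : LipschitzWith 1 (abelMean s) :=
  .of_dist_le_mul fun c d ↦ by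
    simpa only [NNReal.coe_one, one_mul, dist_eq_norm, Real.norm_eq_abs, ← abelMean_sub hs]
      using abs_abelMean_le hs (c - d)

theorem continuous_uncurry_abelMean :
    Continuous fun q : Set.Ioo (0 : ℝ) 1 × ℓ^∞(ℕ, ℝ) ↦ abelMean q.1 q.2 := by
  refine continuous_prod_of_continuous_lipschitzWith' _ 1
    (fun s ↦ lipschitzWith_abelMean s.2) fun c ↦ ?_
  exact continuousOn_iff_continuous_domRestrict.1 <| (continuousOn_const.sub continuousOn_id).mul <|
    (hasFPowerSeriesOnBall_tsum_pow_mul c).continuousOn.mono fun s ↦ mem_eball_zero_one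

theorem ae_abelMean_ne_zero {c : ℓ^∞(ℕ, ℝ)} (hc : c ≠ 0) :
    ∀ᵐ s ∂volume.restrict (Set.Ioo 0 1), abelMean s c ≠ 0 := by
  have hp : FormalMultilinearSeries.ofScalars ℝ (c : ℕ → ℝ) ≠ 0 := fun h ↦
    hc (lp.ext ((FormalMultilinearSeries.ofScalars_series_eq_zero ℝ).1 h))
  have hne := ae_restrict_eball_ne_zero (μ := volume) (hasFPowerSeriesOnBall_tsum_pow_mul c) hp
  filter_upwards [ae_mono (Measure.restrict_mono_set _ fun s ↦ mem_eball_zero_one) hne,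
    ae_restrict_mem measurableSet_Ioo] with s hs hs01
  exact mul_ne_zero (sub_pos.2 hs01.2).ne' hs

end AbelMean

theorem ae_ae_ae_eq_imp_eq {T X Z : Type*} [MeasurableSpace T] [MeasurableSpace X]
    [MeasurableEq X] [MeasurableSpace Z] [MeasurableEq Z] {ν : Measure T} [SFinite ν]
    {μ : Measure X} [SFinite μ] {F : T → X → Z} (hF : Measurable (Function.uncurry F))
    (hne : ∀ x y, x ≠ y → ∀ᵐ t ∂ν, F t x ≠ F t y) :
    ∀ᵐ t ∂ν, ∀ᵐ x ∂μ, ∀ᵐ y ∂μ, F t x = F t y → x = y := by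
  have hmeas : MeasurableSet {q : (X × X) × T | F q.2 q.1.1 = F q.2 q.1.2 → q.1.1 = q.1.2} :=
    (measurableSet_eq_fun (hF.comp (measurable_snd.prodMk measurable_fst.fst))
      (hF.comp (measurable_snd.prodMk measurable_fst.snd))).imp
      (measurableSet_eq_fun measurable_fst.fst measurable_fst.snd)
  have hpair : ∀ q : X × X, ∀ᵐ t ∂ν, F t q.1 = F t q.2 → q.1 = q.2 := fun q ↦ by
    by_cases hq : q.1 = q.2
    · exact .of_forall fun _ _ ↦ hq
    · exact (hne _ _ hq).mono fun t ht h ↦ absurd h ht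
  filter_upwards [(Measure.ae_ae_comm (μ := μ.prod μ) hmeas).1 (.of_forall hpair)] with t ht
  exact Measure.ae_ae_of_ae_prod ht

theorem exists_lipschitzWith_one_ae_ae_eq_imp_eq {X : Type*} [MetricSpace X]
    [TopologicalSpace.SeparableSpace X] [MeasurableSpace X] [BorelSpace X] (μ : Measure X)
    [SFinite μ] :
    ∃ f : X → ℝ, LipschitzWith 1 f ∧ ∀ᵐ x ∂μ, ∀ᵐ y ∂μ, f x = f y → x = y := by
  have : SecondCountableTopology X := UniformSpace.secondCountable_of_separable X
  let ν : Measure (Set.Ioo (0 : ℝ) 1) := volume.comap Subtype.val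
  have : IsProbabilityMeasure ν := ⟨by
    rw [comap_subtype_coe_apply measurableSet_Ioo, Subtype.coe_image_univ, Real.volume_Ioo]
    simp⟩
  have hκ := kuratowskiEmbedding.isometry X
  have hmeas : Measurable fun q : Set.Ioo (0 : ℝ) 1 × X ↦
      abelMean q.1 (kuratowskiEmbedding X q.2) :=
    (continuous_uncurry_abelMean.comp
      (continuous_fst.prodMk (hκ.continuous.comp continuous_snd))).measurable
  have hne : ∀ x y, x ≠ y → ∀ᵐ s : Set.Ioo (0 : ℝ) 1 ∂ν,
      abelMean s (kuratowskiEmbedding X x) ≠ abelMean s (kuratowskiEmbedding X y) :=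
    fun x y hxy ↦ by
      filter_upwards [(ae_restrict_iff_subtype measurableSet_Ioo).1
        (ae_abelMean_ne_zero (sub_ne_zero.2 (hκ.injective.ne hxy)))] with s hs
      rwa [abelMean_sub s.2, sub_ne_zero] at hs
  obtain ⟨s, hs⟩ := (ae_ae_ae_eq_imp_eq (μ := μ) hmeas hne).exists
  exact ⟨abelMean s ∘ kuratowskiEmbedding X,
    by simpa only [one_mul] using (lipschitzWith_abelMean s.2).comp hκ.lipschitz, hs⟩

namespace MMSpace

variable {ι : Type w} {X : MMSpace.{u}} {α : ι → ℝ}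

theorem udiam_eq_zero_of_dominates {Y : MMSpace.{u}} (hYX : Y.Dominates X) {y : ι → Y}
    (hy : Function.Injective y) (hα : ∀ i, ENNReal.ofReal (α i) ≤ Y.μ {y i}) : X.udiam α = 0 := by
  have hA : (fun i ↦ {y i}) ∈ Y.partialFamilies α :=
    ⟨fun i ↦ measurableSet_singleton _,
      fun i j hij ↦ Set.disjoint_singleton.2 (hy.ne hij), hα⟩
  exact le_antisymm (iInf₂_le_of_le Y hYX (iInf₂_le_of_le _ hA (by simp))) zero_le

theorem exists_dominates_of_carries [Countable ι] {x : ι → X}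
    (hx : Carries X.μ (fun i ↦ ENNReal.ofReal (α i)) fun i ↦ {x i}) :
    ∃ Y : MMSpace.{u}, Y.Dominates X ∧
      ∃ y : ι → Y, Function.Injective y ∧ ∀ i, ENNReal.ofReal (α i) ≤ Y.μ {y i} := by
  obtain ⟨ν, hν, hy⟩ := hx.exists_map_fst_eq
  have : IsProbabilityMeasure (ν.map Prod.fst) := hν ▸ X.isProbabilityMeasure
  have : IsProbabilityMeasure ν := Measure.isProbabilityMeasure_of_map Prod.fst
  exact ⟨{ carrier := X × ℕ, μ := ν }, ⟨Prod.fst, LipschitzWith.prod_fst, hν⟩, hy⟩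

theorem udiam_eq_zero_of_carries [Countable ι] {x : ι → X}
    (hx : Carries X.μ (fun i ↦ ENNReal.ofReal (α i)) fun i ↦ {x i}) : X.udiam α = 0 := by
  obtain ⟨Y, hYX, y, hy, hα⟩ := exists_dominates_of_carries hx
  exact udiam_eq_zero_of_dominates hYX hy hα

theorem exists_carries_ediam_le_of_udiam_lt {ε : ℝ≥0∞} (h : X.udiam α < ε) :
    ∃ B : ι → Set X, Carries X.μ (fun i ↦ ENNReal.ofReal (α i)) B ∧
      ∀ i, Metric.ediam (B i) ≤ ε := by
  simp only [udiam, partialDiam, iInf_lt_iff] at h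
  obtain ⟨Y, ⟨F, hF, hFμ⟩, A, ⟨hAm, hAd, hAα⟩, hAε⟩ := h
  refine ⟨fun i ↦ F '' A i, ?_, fun i ↦ ?_⟩
  · rw [← hFμ]
    exact (Carries.of_pairwise_disjoint hAm hAd hAα).image_map hF.continuous.measurable.aemeasurable
  · calc Metric.ediam (F '' A i) ≤ Metric.ediam (A i) := by simpa using hF.ediam_image_le (A i)
      _ ≤ ⨆ i, Metric.ediam (A i) := le_iSup (fun i ↦ Metric.ediam (A i)) i
      _ ≤ ε := hAε.le

theorem exists_carries_of_udiam_eq_zero (hα : ∀ i, 0 < α i) (h : X.udiam α = 0) :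
    ∃ x : ι → X, Carries X.μ (fun i ↦ ENNReal.ofReal (α i)) fun i ↦ {x i} :=
  have := UniformSpace.secondCountable_of_separable X
  exists_carries_singleton_of_forall_ediam_le (fun i ↦ (ENNReal.ofReal_pos.2 (hα i)).ne')
    fun _ hε ↦ exists_carries_ediam_le_of_udiam_lt (h.trans_lt hε)

theorem uObsdiam_eq_zero_of_carries [Countable ι] {x : ι → X}
    (hx : Carries X.μ (fun i ↦ ENNReal.ofReal (α i)) fun i ↦ {x i}) : X.uObsdiam α = 0 := by
  simp only [uObsdiam, ENNReal.iSup_eq_zero]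
  intro f hf
  have hfx := hx.image_map hf.continuous.measurable.aemeasurable
  simp only [Set.image_singleton] at hfx
  exact udiam_eq_zero_of_carries (X := X.pushReal f hf) hfx

theorem exists_carries_of_uObsdiam_eq_zero (hα : ∀ i, 0 < α i) (h : X.uObsdiam α = 0) :
    ∃ x : ι → X, Carries X.μ (fun i ↦ ENNReal.ofReal (α i)) fun i ↦ {x i} := by
  obtain ⟨f, hf, hinj⟩ := exists_lipschitzWith_one_ae_ae_eq_imp_eq X.μ
  simp only [uObsdiam, ENNReal.iSup_eq_zero] at h
  obtain ⟨t, ht⟩ := exists_carries_of_udiam_eq_zero hα (h f hf)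
  exact ht.exists_of_map hf.continuous.measurable hinj fun i ↦ (ENNReal.ofReal_pos.2 (hα i)).ne'

end MMSpace

theorem theorem2_general (X : MMSpace.{u}) {ι : Type w} (α : ι → ℝ) (hα : ∀ i, 0 < α i) :
    List.TFAE [
      ∃ Y : MMSpace.{u}, Y.Dominates X ∧
        ∃ y : ι → Y, Function.Injective y ∧ ∀ i, ENNReal.ofReal (α i) ≤ Y.μ {y i},
      ∃ x : ι → X, ∀ I : Set ι, ∑' i : I, ENNReal.ofReal (α i) ≤ X.μ (x '' I),
      X.udiam α = 0,
      X.uObsdiam α = 0] := by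
  have hcountable {x : ι → X} (hx : Carries X.μ (fun i ↦ ENNReal.ofReal (α i)) fun i ↦ {x i}) :
      Countable ι := hx.countable fun i ↦ (ENNReal.ofReal_pos.2 (hα i)).ne'
  simp only [← carries_singleton_iff (w := fun i ↦ ENNReal.ofReal (α i))]
  tfae_have 1 → 3
  | ⟨_, hYX, _, hy, hyα⟩ => MMSpace.udiam_eq_zero_of_dominates hYX hy hyα
  tfae_have 3 → 2 := MMSpace.exists_carries_of_udiam_eq_zero hα
  tfae_have 2 → 1
  | ⟨_, hx⟩ => have := hcountable hx; MMSpace.exists_dominates_of_carries hx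
  tfae_have 2 → 4
  | ⟨_, hx⟩ => have := hcountable hx; MMSpace.uObsdiam_eq_zero_of_carries hx
  tfae_have 4 → 2 := MMSpace.exists_carries_of_uObsdiam_eq_zero hα
  tfae_finish

theorem theorem2 (X : MMSpace.{u}) (n : ℕ∞) (α : NatUpTo n → ℝ) (hα : ∀ i, 0 < α i) :
    List.TFAE [
      ∃ Y : MMSpace.{u}, Y.Dominates X ∧
        ∃ y : NatUpTo n → Y, Function.Injective y ∧ ∀ i, ENNReal.ofReal (α i) ≤ Y.μ {y i},
      ∃ x : NatUpTo n → X, ∀ I : Set (NatUpTo n),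
        ∑' i : I, ENNReal.ofReal (α i) ≤ X.μ (x '' I),
      X.udiam α = 0,
      X.uObsdiam α = 0] :=
  theorem2_general X α hα
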